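/- Let $R$ be an integral domain, $n=2^m$, and let $i\ge 0$ be an integer with $i\le \log_2 n-3$. Put $N=n/2^{i+1}$ and $K=\frac{(2^{i+1}-1)n}{2^{i+1}}$. For a matrix $M$ of size $2^k$ with $k\ge 1$, with four equal quadrants $M_{11},M_{12},M_{21},M_{22}$, put $$\Delta(M)=\operatorname{Det}(M_{11})\,M_{22}-M_{21}\operatorname{Adj}(M_{11})\,M_{12}.$$ A content of a matrix is a greatest common divisor of all its entries (determined up to units): an element that divides every entry and is divisible by every common divisor of the entries. Let $A=(a_{s,t})$ be the symbolic $n\times n$ matrix, whose entries are $n^2$ distinct indeterminates over $R$. Let $\Delta_0$ be $\Delta(A)$ divided by its content and, for $j\ge 0$, let $\Delta_{j+1}$ be $\Delta(\Delta_j)$ divided by its content; so $\Delta_j$ has size $n/2^{j+1}$ and is determined up to a unit. Let $\Delta_i^{adj}=\operatorname{Adj}(\Delta_i)$, and write $A_{1..K,1..K}$ for the upper left $K\times K$ submatrix of $A$. Then $\Delta_i$ exists (that is, all the contents involved exist), and for every choice of $\Delta_i$ the matrix $\Delta_i^{adj}$ has content $$\operatorname{Det}(A_{1..K,1..K})^{N-2}.$$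 Let $Q$ be the matrix with $\Delta_i^{adj}=\operatorname{Det}(A_{1..K,1..K})^{N-2}\,Q$. Its degree is as follows. 1. Every entry of $Q$ is a polynomial of total degree exactly $n-1$ in the symbols $a_{s,t}$. 2. Let $S$ be a commutative $R$-algebra, and substitute for the $a_{s,t}$ the entries of any $n\times n$ matrix over $S[x_1,\dots,x_r]$ whose entries have total degree at most $d$. Then the identity $\Delta_i^{adj}=\operatorname{Det}(A_{1..K,1..K})^{N-2}\,Q$ continues to hold after the substitution, and every entry of the substituted $Q$ has total degree at most $(n-1)d$. 3. If $r\ge 1$ and the substituted entries are general polynomials of degree $d$ in $x_1,\dots,x_r$ (all coefficients of the monomials of degree at most $d$, in all the entries, are distinct indeterminates over $R$), then every entry of the substituted $Q$ has total degree exactly $(n-1)d$ in $x_1,\dots,x_r$. -/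

import Mathlib

/-- `c` is a content (a greatest common divisor of all the entries) of the matrix `C`: it divides
every entry, and every common divisor of the entries divides it. A content is determined up to
units. -/
def IsContent {S ι κ : Type*} [CommRing S] (c : S) (C : Matrix ι κ S) : Prop :=
  (∀ a b, c ∣ C a b) ∧ ∀ f : S, (∀ a b, f ∣ C a b) → f ∣ c

/-- `D` is the result of dividing `C` elementwise by a content of `C`. -/
def IsCancelled {S ι κ : Type*} [CommRing S] (C D : Matrix ι κ S) : Prop :=
  ∃ c : S, IsContent c C ∧ C = c • D

/-- Indices of the first half of the rows or columns of a matrix of size `2 ^ (k + 1)`. -/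
def firstHalf (k : ℕ) (s : Fin (2 ^ k)) : Fin (2 ^ (k + 1)) :=
  ⟨s, by have := s.2; rw [pow_succ]; omega⟩

/-- Indices of the second half of the rows or columns of a matrix of size `2 ^ (k + 1)`. -/
def secondHalf (k : ℕ) (s : Fin (2 ^ k)) : Fin (2 ^ (k + 1)) :=
  ⟨2 ^ k + s, by have := s.2; rw [pow_succ]; omega⟩

/-- The fraction-free Schur complement `Det(A₁₁) A₂₂ - A₂₁ Adj(A₁₁) A₁₂`, where the `Aᵢⱼ` are the
four equal quadrants of `A`. -/
def fractionFreeDelta {S : Type*} [CommRing S] {k : ℕ}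
    (A : Matrix (Fin (2 ^ (k + 1))) (Fin (2 ^ (k + 1))) S) : Matrix (Fin (2 ^ k)) (Fin (2 ^ k)) S :=
  (A.submatrix (firstHalf k) (firstHalf k)).det • A.submatrix (secondHalf k) (secondHalf k) -
    A.submatrix (secondHalf k) (firstHalf k) *
      (A.submatrix (firstHalf k) (firstHalf k)).adjugate *
      A.submatrix (firstHalf k) (secondHalf k)

/-- `IsReducedDelta i A D`: the matrix `D` is the `i`-th `Δ` of `A` after cancellation of its
content. The `0`-th is the cancelled `Δ` of `A`; the `(i+1)`-st is the cancelled `Δ` of the `i`-th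
(already cancelled) one. -/
inductive IsReducedDelta {S : Type*} [CommRing S] :
    {m k : ℕ} → ℕ → Matrix (Fin (2 ^ m)) (Fin (2 ^ m)) S → Matrix (Fin (2 ^ k)) (Fin (2 ^ k)) S → Prop
  | zero {k : ℕ} (A : Matrix (Fin (2 ^ (k + 1))) (Fin (2 ^ (k + 1))) S)
      (D : Matrix (Fin (2 ^ k)) (Fin (2 ^ k)) S)
      (hD : IsCancelled (fractionFreeDelta A) D) :
      IsReducedDelta 0 A D
  | succ {m k i : ℕ} (A : Matrix (Fin (2 ^ m)) (Fin (2 ^ m)) S)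
      (B : Matrix (Fin (2 ^ (k + 1))) (Fin (2 ^ (k + 1))) S)
      (D : Matrix (Fin (2 ^ k)) (Fin (2 ^ k)) S)
      (hB : IsReducedDelta i A B) (hD : IsCancelled (fractionFreeDelta B) D) :
      IsReducedDelta (i + 1) A D

/-- The determinant of the upper left `r × r` submatrix of an `n × n` matrix, for `r ≤ n`
(equal to `1` for `r = 0`). -/
def leadingMinor {S : Type*} [CommRing S] {n : ℕ} (A : Matrix (Fin n) (Fin n) S) (r : ℕ) : S :=
  (A.submatrix (fun s : {s : Fin n // s.val < r} => s.val)
    (fun s : {s : Fin n // s.val < r} => s.val)).det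

/-- The `n × n` matrix whose entries are the general polynomials of degree `d` in `r` variables:
the coefficients of all the monomials of degree at most `d`, in all the entries, are distinct
indeterminates. -/
noncomputable def genericPolynomialMatrix (R : Type*) [CommRing R] (n r d : ℕ) :
    Matrix (Fin n) (Fin n)
      (MvPolynomial (Fin r) (MvPolynomial (Fin n × Fin n × (Fin r →₀ ℕ)) R)) :=
  Matrix.of fun s t =>
    ∑ e ∈ Finset.range (d + 1), ∑ α ∈ Finset.finsuppAntidiag Finset.univ e,
      MvPolynomial.monomial α (MvPolynomial.X (s, t, α))

/-! Let `δ_K` be the leading `K × K` minor and `C_K = δ_K • S_K` the fraction-free Schur complement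
of the leading `K × K` block (`complement`). Its entries are the bordered minors of that block
(`complement_apply`). Sylvester's identity (`complement_complement`) says that applying `Δ` to `C_K`
gives a power of `δ_K` times the next, larger-block complement. So each reduced `Δ` is some `C_K` up
to a unit, as soon as every `C_K` that occurs has content 1.

For the adjugate, `S_K⁻¹` is the lower right block of `A⁻¹` and `det A = δ_K * det S_K`. Hence
`Adj(C_K)` is `δ_K ^ (N - 2)` times the lower right block of `Adj(A)` (`adjugate_complement`). That
block, up to a unit, is `Q`: its entries are nonzero cofactors, homogeneous of degree `n - 1`, which
yields all three degree statements.

Over a mere domain, greatest common divisors need not exist, so content 1 is proved by exhibiting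
two entries `p`, `q` with `q` a nonzerodivisor modulo `p` (`IsRegularPair`, `isContent_smul`). Both
for `C_K` and for the block of `Adj(A)`, two diagonal entries are principal minors on the indices
`0..K` and `0..K-1, K+1`, for a suitable `K`. A weighted monomial order gives these two minors
coprime leading monomials with coefficients `±1` (`isRegularPair_minors`). -/

/-! ### Weighted monomial orders -/

open scoped MonomialOrder in
/-- The refinement of a monomial order by a weight, which is compared first. -/
noncomputable def MonomialOrder.weighted {σ : Type*} (mo : MonomialOrder σ) (w : σ → ℕ) :
    MonomialOrder σ :=
  let φ : (σ →₀ ℕ) →+ ℕ ×ₗ mo.syn :=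
    { toFun := fun d => toLex (Finsupp.weight w d, mo.toSyn d)
      map_zero' := by simp
      map_add' := fun a b => by simp only [map_add]; rfl }
  have hφ : Function.Injective φ := fun a b h => mo.toSyn.injective (congrArg (fun z => (ofLex z).2) h)
  -- `toSyn` must be bijective, so the carrier is the image of the exponents, not the whole
  -- lexicographic product.
  { syn := AddMonoidHom.mrange φ
    toSyn :=
      { toEquiv := Equiv.ofBijective (fun d => (⟨φ d, d, rfl⟩ : AddMonoidHom.mrange φ))
          ⟨fun a b h => hφ (congrArg Subtype.val h), fun ⟨_, d, hd⟩ => ⟨d, Subtype.ext hd⟩⟩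
        map_add' := fun a b => by
          refine Subtype.ext ?_
          change φ (a + b) = φ a + φ b
          exact map_add φ a b }
    toSyn_monotone := fun a b h => by
      change φ a ≤ φ b
      refine Prod.Lex.toLex_mono ⟨?_, mo.toSyn_monotone h⟩
      obtain ⟨c, rfl⟩ := exists_add_of_le h
      simp }

open scoped MonomialOrder in
theorem MonomialOrder.weighted_lt {σ : Type*} (mo : MonomialOrder σ) (w : σ → ℕ) {a b : σ →₀ ℕ}
    (h : Finsupp.weight w a < Finsupp.weight w b) : a ≺[mo.weighted w] b := by
  change toLex (Finsupp.weight w a, mo.toSyn a) < toLex (Finsupp.weight w b, mo.toSyn b)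
  rw [Prod.Lex.toLex_lt_toLex]
  exact Or.inl h

/-! ### Regular pairs and leading monomials of minors -/

/-- `p` is a nonzero element and `q` is a nonzerodivisor modulo `p`. -/
def IsRegularPair {S : Type*} [CommRing S] (p q : S) : Prop :=
  p ≠ 0 ∧ ∀ x y, p * x = q * y → p ∣ y

-- Reduce `y` modulo `p`. If the remainder `r` were nonzero, `p` would divide `q * r`, so the
-- leading monomial of `p`, being coprime to that of `q`, would divide that of `r`, which division
-- excludes.
open MvPolynomial in
theorem IsRegularPair.of_disjoint_degree {σ R : Type*} [CommRing R] [IsDomain R]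
    (mo : MonomialOrder σ) {p q : MvPolynomial σ R} (hp : IsUnit (mo.leadingCoeff p)) (hq : q ≠ 0)
    (hd : Disjoint (mo.degree p) (mo.degree q)) : IsRegularPair p q := by
  have hp0 : p ≠ 0 := by
    rintro rfl
    simp at hp
  refine ⟨hp0, fun x y h => ?_⟩
  obtain ⟨s, r, rfl, -, hr⟩ := mo.div_single hp y
  suffices r = 0 by subst this; exact ⟨s, by ring⟩
  by_contra hr0
  have h1 : p * (x - q * s) = q * r := by linear_combination h
  have h2 : x - q * s ≠ 0 := by
    intro h0
    rw [h0, mul_zero] at h1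
    exact mul_ne_zero hq hr0 h1.symm
  have h3 := congrArg mo.degree h1
  rw [mo.degree_mul hp0 h2, mo.degree_mul hq hr0] at h3
  refine hr _ (mo.degree_mem_support hr0) fun v => ?_
  have h4 := DFunLike.congr_fun h3 v
  have h5 : (mo.degree p ⊓ mo.degree q) v = 0 := by rw [hd.eq_bot]; rfl
  simp only [Finsupp.add_apply, Finsupp.inf_apply] at h4 h5
  omega

/-- The exponent of the product of the indeterminates that a permutation selects. -/
noncomputable def permExponent {ι κ : Type*} [Fintype ι] (f g : ι → κ) (τ : Equiv.Perm ι) :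
    κ × κ →₀ ℕ := ∑ i, Finsupp.single (f i, g (τ i)) 1

open MvPolynomial in
theorem det_submatrix_mvPolynomialX {R ι κ : Type*} [CommRing R] [Fintype ι] [DecidableEq ι]
    (f g : ι → κ) : ((Matrix.mvPolynomialX κ κ R).submatrix f g).det =
      ∑ τ : Equiv.Perm ι, monomial (permExponent f g τ) ((Equiv.Perm.sign τ : ℤ) : R) := by
  -- Transposing makes each permutation act on the columns, as in `permExponent`.
  rw [← Matrix.det_transpose, Matrix.det_apply']
  refine Finset.sum_congr rfl fun τ _ => ?_
  rw [permExponent, ← mul_one ((Equiv.Perm.sign τ : ℤ) : R), ← C_mul_monomial, monomial_sum_one]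
  simp [Matrix.mvPolynomialX, X]

-- The weight counts the factors at positions in `P`. If `τ₀` is the only permutation staying inside
-- `P`, its term alone attains the maximal weight, whatever `mo` is, and its coefficient is a sign.
open MvPolynomial in
theorem degree_leadingCoeff_det_submatrix {R ι κ : Type*} [CommRing R] [Nontrivial R] [Fintype ι]
    [DecidableEq ι] (mo : MonomialOrder (κ × κ)) (f g : ι → κ) (P : κ × κ → Prop)
    [DecidablePred P] (τ₀ : Equiv.Perm ι) (h₀ : ∀ i, P (f i, g (τ₀ i)))
    (h : ∀ τ : Equiv.Perm ι, (∀ i, P (f i, g (τ i))) → τ = τ₀) :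
    (mo.weighted fun v => if P v then 1 else 0).degree
        ((Matrix.mvPolynomialX κ κ R).submatrix f g).det = permExponent f g τ₀ ∧
      IsUnit ((mo.weighted fun v => if P v then 1 else 0).leadingCoeff
        ((Matrix.mvPolynomialX κ κ R).submatrix f g).det) := by
  classical
  set w : κ × κ → ℕ := fun v => if P v then 1 else 0
  have hw (τ : Equiv.Perm ι) :
      Finsupp.weight w (permExponent f g τ) = ∑ i, w (f i, g (τ i)) := by
    simp [permExponent, map_sum, Finsupp.weight_single]
  have hlt (τ : Equiv.Perm ι) (hτ : τ ≠ τ₀) : Finsupp.weight w (permExponent f g τ) <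
      Finsupp.weight w (permExponent f g τ₀) := by
    rw [hw, hw]
    obtain ⟨i, hi⟩ := not_forall.mp (mt (h τ) hτ)
    refine Finset.sum_lt_sum (fun j _ => ?_) ⟨i, Finset.mem_univ _, ?_⟩
    · simp only [w, if_pos (h₀ j)]
      split_ifs <;> simp
    · simp [w, if_pos (h₀ i), if_neg hi]
  have hcoeff : coeff (permExponent f g τ₀) ((Matrix.mvPolynomialX κ κ R).submatrix f g).det =
      ((Equiv.Perm.sign τ₀ : ℤ) : R) := by
    rw [det_submatrix_mvPolynomialX, coeff_sum, Finset.sum_eq_single τ₀]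
    · simp
    · intro τ _ hτ
      rw [coeff_monomial, if_neg]
      intro he
      have := hlt τ hτ
      rw [he] at this
      exact this.false
    · simp
  have hu : IsUnit ((Equiv.Perm.sign τ₀ : ℤ) : R) :=
    (Units.isUnit (Equiv.Perm.sign τ₀)).map (Int.castRingHom R)
  have hdeg : (mo.weighted w).degree ((Matrix.mvPolynomialX κ κ R).submatrix f g).det =
      permExponent f g τ₀ := by
    apply (mo.weighted w).toSyn.injective
    apply le_antisymm
    · rw [(mo.weighted w).degree_le_iff]
      intro b hb
      rw [det_submatrix_mvPolynomialX] at hb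
      obtain ⟨τ, -, hτ⟩ := Finset.mem_biUnion.mp (support_sum hb)
      rw [Finset.mem_singleton.mp (support_monomial_subset hτ)]
      by_cases he : τ = τ₀
      · rw [he]
      · exact (mo.weighted_lt w (hlt τ he)).le
    · apply (mo.weighted w).le_degree
      rw [mem_support_iff, hcoeff]
      exact hu.ne_zero
  refine ⟨hdeg, ?_⟩
  rw [MonomialOrder.leadingCoeff, hdeg, hcoeff]
  exact hu

/-- The values of any two permutations have the same sum. -/
theorem Equiv.Perm.eq_of_forall_le {n : ℕ} {σ τ : Equiv.Perm (Fin n)} (h : ∀ i, σ i ≤ τ i) :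
    σ = τ := by
  have h1 : ∑ i, ((σ i : Fin n) : ℕ) = ∑ i, ((τ i : Fin n) : ℕ) := by
    exact (Equiv.sum_comp σ fun i => (i : ℕ)).trans (Equiv.sum_comp τ fun i => (i : ℕ)).symm
  rw [Finset.sum_eq_sum_iff_of_le fun i _ => Fin.le_def.mp (h i)] at h1
  ext i
  exact h1 i (Finset.mem_univ i)

/-- The lexicographic order for some linear order on a finite set of indeterminates. -/
noncomputable def MonomialOrder.ofFinite (σ : Type*) [Finite σ] : MonomialOrder σ :=
  letI : LinearOrder σ := IsWellOrder.linearOrder WellOrderingRel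
  haveI : WellFoundedGT σ := Finite.to_wellFoundedGT
  MonomialOrder.lex

theorem isRegularPair_minors {R : Type*} [CommRing R] [IsDomain R] {n K : ℕ}
    (f g : Fin (K + 1) → Fin n) (hf : ∀ j, (f j : ℕ) = j)
    (hg : ∀ j : Fin (K + 1), (g j : ℕ) = if (j : ℕ) < K then (j : ℕ) else K + 1) :
    IsRegularPair ((Matrix.mvPolynomialX (Fin n) (Fin n) R).submatrix f f).det
      ((Matrix.mvPolynomialX (Fin n) (Fin n) R).submatrix g g).det := by
  classical
  -- `P` is the union of the two intended leading monomials: the cycle `(0,1), …, (K-1,K), (K,0)`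
  -- for the first minor, the diagonal for the second. Within `P`, a row below `K` may only stay or
  -- move one step right. In the first minor row `K` must go to column `0`, so a permutation inside
  -- `P` is bounded above by the cycle; in the second it is bounded below by the identity. Either
  -- bound forces equality.
  let P : Fin n × Fin n → Prop := fun v =>
    ((v.1 : ℕ) = K ∧ (v.2 : ℕ) = 0) ∨ ((v.1 : ℕ) < K ∧ (v.2 : ℕ) = v.1 + 1) ∨
      ((v.1 : ℕ) < K ∧ (v.2 : ℕ) = v.1) ∨ ((v.1 : ℕ) = K + 1 ∧ (v.2 : ℕ) = K + 1)
  have hrot (i : Fin (K + 1)) :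
      (finRotate (K + 1) i : ℕ) = if (i : ℕ) < K then (i : ℕ) + 1 else 0 := by
    split_ifs with h
    · rw [coe_finRotate_of_ne_last]
      intro h'
      simp [h'] at h
    · have : i = Fin.last K := Fin.ext (by simp; omega)
      rw [this, finRotate_last]
      rfl
  have hp := degree_leadingCoeff_det_submatrix (R := R) (MonomialOrder.ofFinite _) f f P
    (finRotate (K + 1)) (fun i => by
      simp only [P, hf, hrot]
      have := i.2
      split_ifs <;> omega) (fun τ hτ => by
      refine Equiv.Perm.eq_of_forall_le fun i => ?_
      have := hτ i
      have := i.2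
      have := hrot i
      simp only [P, hf] at *
      rw [Fin.le_def]
      split_ifs at * <;> omega)
  have hq := degree_leadingCoeff_det_submatrix (R := R) (MonomialOrder.ofFinite _) g g P
    1 (fun i => by
      simp only [P, hg, Equiv.Perm.coe_one, id, and_true]
      split_ifs <;> omega) (fun τ hτ => by
      refine (Equiv.Perm.eq_of_forall_le fun i => ?_).symm
      have := hτ i
      have := i.2
      have := (τ i).2
      simp only [P, hg, Equiv.Perm.coe_one, id] at *
      rw [Fin.le_def]
      split_ifs at * <;> omega)
  refine IsRegularPair.of_disjoint_degree _ hp.2 ?_ ?_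
  · intro h0
    have := hq.2
    rw [h0] at this
    simp at this
  · rw [hp.1, hq.1]
    rw [disjoint_iff]
    ext v
    simp only [permExponent, Finsupp.inf_apply, Finsupp.coe_finsetSum, Finset.sum_apply]
    by_contra hne
    have hne' : 0 < min (∑ i, Finsupp.single (f i, f (finRotate (K + 1) i)) 1 v)
        (∑ i, Finsupp.single (g i, g ((1 : Equiv.Perm (Fin (K + 1))) i)) 1 v) :=
      Nat.pos_of_ne_zero hne
    rw [lt_min_iff] at hne'
    obtain ⟨i, -, hi⟩ := Finset.exists_ne_zero_of_sum_ne_zero hne'.1.ne'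
    obtain ⟨j, -, hj⟩ := Finset.exists_ne_zero_of_sum_ne_zero hne'.2.ne'
    rw [Finsupp.single_apply_ne_zero] at hi hj
    have h1 := hi.1.symm.trans hj.1
    rw [Prod.ext_iff, Fin.ext_iff, Fin.ext_iff] at h1
    simp only [hf, hg, hrot, Equiv.Perm.coe_one, id] at h1
    have := i.2
    have := j.2
    split_ifs at h1 <;> omega

/-! ### Splitting the indices into head and tail -/

section SplitIndex

variable {K N n : ℕ}

/-- The first `K` of `n = K + N` indices. -/
def headIndex (h : K + N = n) (s : Fin K) : Fin n := ⟨s, by omega⟩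

/-- The last `N` of `n = K + N` indices. -/
def tailIndex (h : K + N = n) (s : Fin N) : Fin n := ⟨K + s, by omega⟩

/-- The splitting of `n = K + N` indices into the first `K` and the last `N` ones. -/
def splitEquiv (h : K + N = n) : Fin K ⊕ Fin N ≃ Fin n := finSumFinEquiv.trans (finCongr h)

theorem coe_splitEquiv (h : K + N = n) :
    ⇑(splitEquiv h) = Sum.elim (headIndex h) (tailIndex h) := by
  ext (s | s) <;> simp [splitEquiv, headIndex, tailIndex]

end SplitIndex

/-! ### Fraction-free Schur complements -/

section Complement

variable {S : Type*} [CommRing S] {K N n : ℕ}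

/-- The fraction-free Schur complement of the upper left `K × K` block. -/
def complement (h : K + N = n) (A : Matrix (Fin n) (Fin n) S) : Matrix (Fin N) (Fin N) S :=
  (A.submatrix (headIndex h) (headIndex h)).det • A.submatrix (tailIndex h) (tailIndex h) -
    A.submatrix (tailIndex h) (headIndex h) *
      (A.submatrix (headIndex h) (headIndex h)).adjugate *
      A.submatrix (headIndex h) (tailIndex h)

theorem fractionFreeDelta_eq_complement {k : ℕ}
    (A : Matrix (Fin (2 ^ (k + 1))) (Fin (2 ^ (k + 1))) S) (h : 2 ^ k + 2 ^ k = 2 ^ (k + 1)) :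
    fractionFreeDelta A = complement h A := rfl

theorem leadingMinor_eq_det (h : K + N = n) (A : Matrix (Fin n) (Fin n) S) :
    leadingMinor A K = (A.submatrix (headIndex h) (headIndex h)).det := by
  let e : Fin K ≃ {s : Fin n // s.val < K} :=
    { toFun := fun s => ⟨headIndex h s, s.2⟩
      invFun := fun s => ⟨s.1, s.2⟩
      left_inv := fun s => rfl
      right_inv := fun s => rfl }
  rw [leadingMinor, ← Matrix.det_submatrix_equiv_self e]
  rfl

theorem map_complement {T : Type*} [CommRing T] (φ : S →+* T) (h : K + N = n)
    (A : Matrix (Fin n) (Fin n) S) : complement h (A.map φ) = (complement h A).map φ := by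
  have hadj : ((A.submatrix (headIndex h) (headIndex h)).map φ).adjugate =
      (A.submatrix (headIndex h) (headIndex h)).adjugate.map φ :=
    (φ.map_adjugate (A.submatrix (headIndex h) (headIndex h))).symm
  have hdet : ((A.submatrix (headIndex h) (headIndex h)).map φ).det =
      φ (A.submatrix (headIndex h) (headIndex h)).det :=
    (φ.map_det (A.submatrix (headIndex h) (headIndex h))).symm
  simp only [complement, Matrix.submatrix_map, hadj, hdet]
  ext a b
  simp only [Matrix.sub_apply, Matrix.smul_apply, Matrix.map_apply, map_sub, smul_eq_mul, map_mul]
  rw [← Matrix.map_mul, ← Matrix.map_mul]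
  rfl

theorem complement_smul [NeZero K] (h : K + N = n) (c : S) (A : Matrix (Fin n) (Fin n) S) :
    complement h (c • A) = c ^ (K + 1) • complement h A := by
  obtain ⟨k, hk⟩ := Nat.exists_eq_succ_of_ne_zero (NeZero.ne K)
  subst hk
  simp only [complement, Matrix.submatrix_smul, Pi.smul_apply, Matrix.det_smul,
    Matrix.adjugate_smul, Fintype.card_fin, Matrix.smul_mul, Matrix.mul_smul, smul_smul, smul_sub,
    Nat.succ_eq_add_one, Nat.add_sub_cancel]
  congr 2 <;> ring

end Complement

/-! ### Schur complements over a field -/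

section Field

variable {F : Type*} [Field F] {K N n : ℕ}

/-- The Schur complement of the upper left `K × K` block. -/
noncomputable def schurComplement (h : K + N = n) (A : Matrix (Fin n) (Fin n) F) :
    Matrix (Fin N) (Fin N) F :=
  A.submatrix (tailIndex h) (tailIndex h) - A.submatrix (tailIndex h) (headIndex h) *
    (A.submatrix (headIndex h) (headIndex h))⁻¹ * A.submatrix (headIndex h) (tailIndex h)

variable (h : K + N = n) (A : Matrix (Fin n) (Fin n) F)

theorem adjugate_eq_det_smul_inv {ι : Type*} [Fintype ι] [DecidableEq ι] {M : Matrix ι ι F}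
    (hM : M.det ≠ 0) : M.adjugate = M.det • M⁻¹ := by
  rw [Matrix.inv_def, smul_smul, Ring.inverse_eq_inv', mul_inv_cancel₀ hM, one_smul]

theorem complement_eq_smul_schurComplement
    (hA : (A.submatrix (headIndex h) (headIndex h)).det ≠ 0) :
    complement h A = (A.submatrix (headIndex h) (headIndex h)).det • schurComplement h A := by
  rw [complement, schurComplement, adjugate_eq_det_smul_inv hA, smul_sub, Matrix.mul_smul, Matrix.smul_mul]

theorem submatrix_sumElim_eq_fromBlocks {α ι κ ι' : Type*} (A : Matrix ι ι α) (f : κ → ι)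
    (g g' : ι' → ι) : A.submatrix (Sum.elim f g) (Sum.elim f g') =
      Matrix.fromBlocks (A.submatrix f f) (A.submatrix f g') (A.submatrix g f)
        (A.submatrix g g') := by
  ext (i | i) (j | j) <;> rfl

/-- Eliminating the head block commutes with selecting tail rows and columns, so the bordered matrix
has the corresponding submatrix of `schurComplement h A` as its own Schur complement. -/
theorem det_submatrix_eq_mul_det_schurComplement {ι : Type*} [Fintype ι] [DecidableEq ι]
    (hA : (A.submatrix (headIndex h) (headIndex h)).det ≠ 0) (f g : ι → Fin N) :
    (A.submatrix (Sum.elim (headIndex h) (tailIndex h ∘ f))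
      (Sum.elim (headIndex h) (tailIndex h ∘ g))).det =
    (A.submatrix (headIndex h) (headIndex h)).det * ((schurComplement h A).submatrix f g).det := by
  let := Matrix.invertibleOfIsUnitDet _ (isUnit_iff_ne_zero.mpr hA)
  rw [submatrix_sumElim_eq_fromBlocks, Matrix.det_fromBlocks₁₁, Matrix.invOf_eq_nonsing_inv]
  rfl

theorem det_eq_mul_det_schurComplement
    (hA : (A.submatrix (headIndex h) (headIndex h)).det ≠ 0) :
    A.det = (A.submatrix (headIndex h) (headIndex h)).det * (schurComplement h A).det := by
  have := det_submatrix_eq_mul_det_schurComplement h A hA id id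
  rwa [Function.comp_id, ← coe_splitEquiv, Matrix.det_submatrix_equiv_self,
    Matrix.submatrix_id_id] at this

theorem inv_schurComplement (hA : (A.submatrix (headIndex h) (headIndex h)).det ≠ 0)
    (hA' : A.det ≠ 0) :
    (schurComplement h A)⁻¹ = A⁻¹.submatrix (tailIndex h) (tailIndex h) := by
  have hS : (schurComplement h A).det ≠ 0 := by
    intro h0
    rw [det_eq_mul_det_schurComplement h A hA, h0, mul_zero] at hA'
    exact hA' rfl
  have hB : A.submatrix (splitEquiv h) (splitEquiv h) =
      Matrix.fromBlocks (A.submatrix (headIndex h) (headIndex h))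
        (A.submatrix (headIndex h) (tailIndex h)) (A.submatrix (tailIndex h) (headIndex h))
        (A.submatrix (tailIndex h) (tailIndex h)) := by
    rw [coe_splitEquiv, submatrix_sumElim_eq_fromBlocks]
  let := Matrix.invertibleOfIsUnitDet _ (isUnit_iff_ne_zero.mpr hA)
  let : Invertible (A.submatrix (tailIndex h) (tailIndex h) -
      A.submatrix (tailIndex h) (headIndex h) *
        ⅟(A.submatrix (headIndex h) (headIndex h)) * A.submatrix (headIndex h) (tailIndex h)) := by
    rw [Matrix.invOf_eq_nonsing_inv]
    exact Matrix.invertibleOfIsUnitDet _ (isUnit_iff_ne_zero.mpr hS)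
  let := Matrix.fromBlocks₁₁Invertible (A.submatrix (headIndex h) (headIndex h))
    (A.submatrix (headIndex h) (tailIndex h)) (A.submatrix (tailIndex h) (headIndex h))
    (A.submatrix (tailIndex h) (tailIndex h))
  have key := Matrix.invOf_fromBlocks₁₁_eq (A.submatrix (headIndex h) (headIndex h))
    (A.submatrix (headIndex h) (tailIndex h)) (A.submatrix (tailIndex h) (headIndex h))
    (A.submatrix (tailIndex h) (tailIndex h))
  simp only [Matrix.invOf_eq_nonsing_inv] at key
  rw [← hB, Matrix.inv_submatrix_equiv] at key
  have key2 := congrArg Matrix.toBlocks₂₂ key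
  rw [Matrix.toBlocks_fromBlocks₂₂] at key2
  rw [schurComplement, ← key2]
  ext a b
  simp [Matrix.toBlocks₂₂, coe_splitEquiv]

/-- With `δ` the head minor and `S` the Schur complement, `Adj(δ S) = δ ^ (N - 1) * det S • S⁻¹`.
One factor `δ` joins `det S` to form `det A`, and `det A • A⁻¹` is the adjugate of `A`. -/
theorem adjugate_complement_of_field (hN : 2 ≤ N)
    (hA : (A.submatrix (headIndex h) (headIndex h)).det ≠ 0) (hA' : A.det ≠ 0) :
    (complement h A).adjugate = (A.submatrix (headIndex h) (headIndex h)).det ^ (N - 2) •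
      A.adjugate.submatrix (tailIndex h) (tailIndex h) := by
  have hS : (schurComplement h A).det ≠ 0 := by
    intro h0
    rw [det_eq_mul_det_schurComplement h A hA, h0, mul_zero] at hA'
    exact hA' rfl
  rw [complement_eq_smul_schurComplement h A hA, Matrix.adjugate_smul, adjugate_eq_det_smul_inv hS,
    inv_schurComplement h A hA hA', adjugate_eq_det_smul_inv hA', Matrix.submatrix_smul,
    Pi.smul_apply, Pi.smul_apply, smul_smul, smul_smul, det_eq_mul_det_schurComplement h A hA,
    Fintype.card_fin]
  obtain ⟨r, rfl⟩ := Nat.exists_eq_add_of_le hN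
  rw [show 2 + r - 1 = r + 1 by omega, show 2 + r - 2 = r by omega]
  congr 1
  ring

end Field

/-! ### Determinantal identities over a domain, by passing to the fraction field -/

section Domain

variable {S : Type*} [CommRing S] {K N n : ℕ}

theorem map_injective_fractionRing {ι κ : Type*} {B C : Matrix ι κ S}
    (h : B.map (algebraMap S (FractionRing S)) = C.map (algebraMap S (FractionRing S))) : B = C :=
  Matrix.map_injective (IsFractionRing.injective S (FractionRing S)) h

theorem det_map_fractionRing {ι : Type*} [Fintype ι] [DecidableEq ι] (M : Matrix ι ι S) :
    (M.map (algebraMap S (FractionRing S))).det = algebraMap S (FractionRing S) M.det :=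
  ((algebraMap S (FractionRing S)).map_det M).symm

theorem det_map_fractionRing_ne_zero {ι : Type*} [Fintype ι] [DecidableEq ι] {M : Matrix ι ι S}
    (hM : M.det ≠ 0) : (M.map (algebraMap S (FractionRing S))).det ≠ 0 := by
  rw [det_map_fractionRing]
  exact (map_ne_zero_iff _ (IsFractionRing.injective S (FractionRing S))).mpr hM

variable [IsDomain S]

theorem complement_apply (h : K + N = n) (A : Matrix (Fin n) (Fin n) S)
    (hA : (A.submatrix (headIndex h) (headIndex h)).det ≠ 0) (a b : Fin N) :
    complement h A a b = (A.submatrix (Sum.elim (headIndex h) fun _ : Fin 1 => tailIndex h a)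
      (Sum.elim (headIndex h) fun _ : Fin 1 => tailIndex h b)).det := by
  set φ := algebraMap S (FractionRing S) with hφ
  apply IsFractionRing.injective S (FractionRing S)
  have hA' := det_map_fractionRing_ne_zero hA
  rw [← hφ, ← Matrix.submatrix_map] at hA'
  have := det_submatrix_eq_mul_det_schurComplement h (A.map φ) hA' (fun _ : Fin 1 => a) fun _ => b
  rw [Matrix.det_fin_one, Matrix.submatrix_apply] at this
  rw [← hφ, ← det_map_fractionRing, ← hφ, ← Matrix.submatrix_map]
  refine Eq.trans ?_ this.symm
  rw [← Matrix.map_apply (f := φ) (M := complement h A), ← map_complement,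
    complement_eq_smul_schurComplement h _ hA']
  rfl

theorem adjugate_complement (h : K + N = n) (A : Matrix (Fin n) (Fin n) S) (hN : 2 ≤ N)
    (hA : (A.submatrix (headIndex h) (headIndex h)).det ≠ 0) (hA' : A.det ≠ 0) :
    (complement h A).adjugate = (A.submatrix (headIndex h) (headIndex h)).det ^ (N - 2) •
      A.adjugate.submatrix (tailIndex h) (tailIndex h) := by
  set φ := algebraMap S (FractionRing S) with hφ
  apply map_injective_fractionRing
  have h1 := det_map_fractionRing_ne_zero hA
  rw [← hφ, ← Matrix.submatrix_map] at h1
  have := adjugate_complement_of_field h (A.map φ) hN h1 (det_map_fractionRing_ne_zero hA')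
  have h2 := φ.map_adjugate (complement h A)
  have h3 := φ.map_adjugate A
  simp only [RingHom.mapMatrix_apply] at h2 h3
  rw [← hφ, h2, ← map_complement, this, ← h3, Matrix.submatrix_map, hφ, det_map_fractionRing]
  ext a b
  simp

/-- Sylvester's identity. Pulling the head minor `δ` out of the inner complement gives `δ ^ (L + 1)`
times bordered minors of the Schur complement; one `δ` turns each of these into a bordered minor of
`A`, leaving `δ ^ L`. -/
theorem complement_complement_of_field {F : Type*} [Field F] {K L M N n : ℕ} [NeZero L]
    (hK : K + M = n) (hL : L + N = M) (hKL : K + L + N = n) (A : Matrix (Fin n) (Fin n) F)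
    (hA : (A.submatrix (headIndex hK) (headIndex hK)).det ≠ 0)
    (hA' : (A.submatrix (headIndex hKL) (headIndex hKL)).det ≠ 0) :
    complement hL (complement hK A) =
      (A.submatrix (headIndex hK) (headIndex hK)).det ^ L • complement hKL A := by
  have e1 : Sum.elim (headIndex hK) (tailIndex hK ∘ headIndex hL) =
      headIndex hKL ∘ finSumFinEquiv := by
    ext (s | s) <;> simp [headIndex, tailIndex]
  have h1 : ((schurComplement hK A).submatrix (headIndex hL) (headIndex hL)).det ≠ 0 := by
    have := det_submatrix_eq_mul_det_schurComplement hK A hA (headIndex hL) (headIndex hL)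
    rw [e1, ← Matrix.submatrix_submatrix, Matrix.det_submatrix_equiv_self] at this
    exact right_ne_zero_of_mul (this ▸ hA')
  -- Bordering `K` indices by `L` and then by one more is bordering the first `K + L` indices by
  -- one.
  have e2 (a : Fin N) : Sum.elim (headIndex hK)
      (tailIndex hK ∘ Sum.elim (headIndex hL) fun _ : Fin 1 => tailIndex hL a) =
      (Sum.elim (headIndex hKL) fun _ : Fin 1 => tailIndex hKL a) ∘
        ((Equiv.sumAssoc _ _ _).symm.trans (finSumFinEquiv.sumCongr (Equiv.refl _))) := by
    ext (s | s | s) <;> simp [headIndex, tailIndex]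
    omega
  rw [complement_eq_smul_schurComplement hK A hA, complement_smul]
  ext a b
  rw [Matrix.smul_apply, Matrix.smul_apply, complement_apply hL _ h1, complement_apply hKL A hA']
  have := det_submatrix_eq_mul_det_schurComplement hK A hA
    (Sum.elim (headIndex hL) fun _ : Fin 1 => tailIndex hL a)
    (Sum.elim (headIndex hL) fun _ : Fin 1 => tailIndex hL b)
  rw [e2, e2, ← Matrix.submatrix_submatrix, Matrix.det_submatrix_equiv_self] at this
  rw [this, smul_eq_mul, smul_eq_mul]
  ring

theorem complement_complement {K L M N n : ℕ} [NeZero L]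
    (hK : K + M = n) (hL : L + N = M) (hKL : K + L + N = n) (A : Matrix (Fin n) (Fin n) S)
    (hA : (A.submatrix (headIndex hK) (headIndex hK)).det ≠ 0)
    (hA' : (A.submatrix (headIndex hKL) (headIndex hKL)).det ≠ 0) :
    complement hL (complement hK A) =
      (A.submatrix (headIndex hK) (headIndex hK)).det ^ L • complement hKL A := by
  set φ := algebraMap S (FractionRing S) with hφ
  apply map_injective_fractionRing
  have h1 := det_map_fractionRing_ne_zero hA
  have h2 := det_map_fractionRing_ne_zero hA'
  rw [← hφ, ← Matrix.submatrix_map] at h1 h2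
  have := complement_complement_of_field hK hL hKL (A.map φ) h1 h2
  rw [← hφ, ← map_complement, ← map_complement, this, map_complement, Matrix.submatrix_map, hφ,
    det_map_fractionRing]
  ext a b
  simp

end Domain

/-! ### Contents from regular pairs -/

section Content

variable {S : Type*} [CommRing S] [IsDomain S] {ι κ : Type*}

/-- If `g p = f x` and `g q = f y` with `f ≠ 0`, then `p y = q x`, so regularity gives `x = p k` and
hence `g = f k`. -/
theorem isContent_smul {C : Matrix ι κ S} {a a' : ι} {b b' : κ}
    (hC : IsRegularPair (C a b) (C a' b')) (g : S) : IsContent g (g • C) := by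
  refine ⟨fun s t => ⟨C s t, rfl⟩, fun f hf => ?_⟩
  obtain ⟨x, hx⟩ := hf a b
  obtain ⟨y, hy⟩ := hf a' b'
  rw [Matrix.smul_apply, smul_eq_mul] at hx hy
  by_cases hf0 : f = 0
  · rw [hf0, zero_mul] at hx
    rw [(mul_eq_zero.mp hx).resolve_right hC.1]
    exact dvd_zero f
  · obtain ⟨k, rfl⟩ := hC.2 y x (mul_left_cancel₀ hf0 (by
      linear_combination C a' b' * hx - C a b * hy))
    exact ⟨k, mul_right_cancel₀ hC.1 (by linear_combination hx)⟩

theorem IsContent.unit_smul {S ι κ : Type*} [CommRing S] {C : Matrix ι κ S} {c : S}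
    (hc : IsContent c C) {u : S} (hu : IsUnit u) : IsContent c (u • C) := by
  simpa [IsContent, hu.dvd_mul_left] using hc

theorem isCancelled_smul {C : Matrix ι κ S} {a a' : ι} {b b' : κ}
    (hC : IsRegularPair (C a b) (C a' b')) (g : S) : IsCancelled (g • C) C :=
  ⟨g, isContent_smul hC g, rfl⟩

theorem IsCancelled.exists_eq_smul {C D : Matrix ι κ S} {a a' : ι} {b b' : κ}
    (hC : IsRegularPair (C a b) (C a' b')) {g : S} (hg : g ≠ 0) (hD : IsCancelled (g • C) D) :
    ∃ u : S, IsUnit u ∧ D = u • C := by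
  obtain ⟨c, hc, h⟩ := hD
  have hgC := isContent_smul hC g
  obtain ⟨u, rfl⟩ := associated_of_dvd_dvd (hgC.2 c hc.1) (hc.2 g hgC.1)
  refine ⟨u, u.isUnit, ?_⟩
  ext s t
  have := congrFun (congrFun h s) t
  simp only [Matrix.smul_apply, smul_eq_mul] at this ⊢
  exact mul_left_cancel₀ (left_ne_zero_of_mul hg) (by rw [← this]; ring)

end Content

/-! ### The reduced complements -/

/-- The leading principal minors are nonzero, and each of them forms a regular pair with the minor
obtained by increasing its last row and column index by one. -/
structure HasRegularMinors {S : Type*} [CommRing S] {n : ℕ} (A : Matrix (Fin n) (Fin n) S) :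
    Prop where
  det_head_ne_zero : ∀ {K N : ℕ} (h : K + N = n),
    (A.submatrix (headIndex h) (headIndex h)).det ≠ 0
  isRegularPair : ∀ {K : ℕ} (f g : Fin (K + 1) → Fin n), (∀ j, (f j : ℕ) = j) →
    (∀ j : Fin (K + 1), (g j : ℕ) = if (j : ℕ) < K then (j : ℕ) else K + 1) →
    IsRegularPair (A.submatrix f f).det (A.submatrix g g).det

section RegularMinors

variable {S : Type*} [CommRing S] {K N n : ℕ} {A : Matrix (Fin n) (Fin n) S}

/-- The last two diagonal cofactors delete the index `n - 1` or `n - 2`, leaving `0..n-2` or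
`0..n-3, n-1`; their signs are `+1`. -/
theorem HasRegularMinors.adjugate (hA : HasRegularMinors A) (h : K + N = n) (hN : 2 ≤ N) :
    ∃ a b : Fin N, IsRegularPair (A.adjugate.submatrix (tailIndex h) (tailIndex h) a a)
      (A.adjugate.submatrix (tailIndex h) (tailIndex h) b b) := by
  obtain ⟨r, rfl⟩ : ∃ r, n = r + 1 + 1 := ⟨n - 2, by omega⟩
  refine ⟨⟨N - 1, by omega⟩, ⟨N - 2, by omega⟩, ?_⟩
  rw [Matrix.submatrix_apply, Matrix.submatrix_apply, Matrix.adjugate_fin_succ_eq_det_submatrix,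
    Matrix.adjugate_fin_succ_eq_det_submatrix, (Even.add_self _).neg_one_pow,
    (Even.add_self _).neg_one_pow, one_mul, one_mul]
  refine hA.isRegularPair _ _ (fun j => ?_) fun j => ?_ <;>
  · have := j.2
    simp only [Fin.succAbove, tailIndex, Fin.lt_def, Fin.val_castSucc]
    split_ifs <;> simp <;> omega

variable [IsDomain S]

/-- These entries are the minors bordering the first `K` indices by index `K` and by index `K + 1`.
-/
theorem HasRegularMinors.complement (hA : HasRegularMinors A) (h : K + N = n) (hN : 2 ≤ N) :
    IsRegularPair (complement h A ⟨0, by omega⟩ ⟨0, by omega⟩)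
      (complement h A ⟨1, by omega⟩ ⟨1, by omega⟩) := by
  rw [complement_apply h A (hA.det_head_ne_zero h), complement_apply h A (hA.det_head_ne_zero h),
    ← Matrix.det_submatrix_equiv_self finSumFinEquiv.symm,
    ← Matrix.det_submatrix_equiv_self finSumFinEquiv.symm]
  refine hA.isRegularPair _ _ (fun j => ?_) fun j => ?_ <;>
  obtain ⟨s, rfl⟩ := finSumFinEquiv.surjective j <;>
  rcases s with s | s <;> simp [headIndex, tailIndex]

theorem isReducedDelta_complement (i : ℕ) : ∀ {m k K : ℕ} (A : Matrix (Fin (2 ^ m)) (Fin (2 ^ m)) S)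
    (h : K + 2 ^ k = 2 ^ m), HasRegularMinors A → 1 ≤ k → k + i + 1 = m →
    IsReducedDelta i A (complement h A) := by
  induction i with
  | zero =>
    intro m k K A h hA hk hm
    obtain rfl : m = k + 1 := by omega
    obtain rfl : K = 2 ^ k := by rw [pow_succ] at h; omega
    refine .zero A _ ?_
    rw [fractionFreeDelta_eq_complement A h, ← one_smul S (complement h A)]
    simpa only [one_smul] using
      isCancelled_smul (hA.complement h (Nat.one_lt_two_pow (by omega))) 1
  | succ i ih =>
    intro m k K A h hA hk hm
    have hpow : 2 ^ (k + 1) ≤ 2 ^ m := Nat.pow_le_pow_right (by norm_num) (by omega)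
    obtain ⟨L, rfl⟩ : ∃ L, K = L + 2 ^ k := ⟨K - 2 ^ k, by rw [pow_succ] at *; omega⟩
    have hL : 2 ^ k + 2 ^ k = 2 ^ (k + 1) := by rw [pow_succ]; omega
    have h' : L + 2 ^ (k + 1) = 2 ^ m := by omega
    refine .succ A _ _ (ih A h' hA (by omega) (by omega)) ?_
    rw [fractionFreeDelta_eq_complement _ hL, complement_complement h' hL h A
      (hA.det_head_ne_zero _) (hA.det_head_ne_zero _)]
    exact isCancelled_smul (hA.complement h (Nat.one_lt_two_pow (by omega))) _

/-- Uniqueness up to units: an earlier choice of unit only rescales the next `Δ` by a power of it,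
and Sylvester's factor is absorbed by the content. `K` is determined by `h`. -/
theorem IsReducedDelta.exists_eq_smul {m k i : ℕ} {A : Matrix (Fin (2 ^ m)) (Fin (2 ^ m)) S}
    {D : Matrix (Fin (2 ^ k)) (Fin (2 ^ k)) S} (hD : IsReducedDelta i A D)
    (hA : HasRegularMinors A) (hk : 1 ≤ k) :
    ∃ (K : ℕ) (h : K + 2 ^ k = 2 ^ m) (u : S), IsUnit u ∧ D = u • complement h A := by
  induction hD with
  | @zero k A D hD =>
    have h : 2 ^ k + 2 ^ k = 2 ^ (k + 1) := by rw [pow_succ]; omega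
    rw [fractionFreeDelta_eq_complement A h, ← one_smul S (complement h A)] at hD
    exact ⟨_, h, hD.exists_eq_smul (hA.complement h (Nat.one_lt_two_pow (by omega))) one_ne_zero⟩
  | @succ m k i A B D hB hD ih =>
    obtain ⟨K, h, u, hu, rfl⟩ := ih hA (by omega)
    have hL : 2 ^ k + 2 ^ k = 2 ^ (k + 1) := by rw [pow_succ]; omega
    have hKL : K + 2 ^ k + 2 ^ k = 2 ^ m := by omega
    rw [fractionFreeDelta_eq_complement _ hL, complement_smul, complement_complement h hL hKL A
      (hA.det_head_ne_zero _) (hA.det_head_ne_zero _), smul_smul] at hD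
    exact ⟨_, hKL, hD.exists_eq_smul (hA.complement hKL (Nat.one_lt_two_pow (by omega)))
      (mul_ne_zero (pow_ne_zero _ hu.ne_zero) (pow_ne_zero _ (hA.det_head_ne_zero h)))⟩

end RegularMinors

/-! ### The symbolic matrix, and degrees under substitution -/

section Generic

open MvPolynomial

variable {R : Type*} [CommRing R]

/-- For injective `f` and `g` the minor is a symbolic determinant with its indeterminates
injectively renamed. -/
theorem det_submatrix_mvPolynomialX_ne_zero [Nontrivial R] {ι κ : Type*} [Fintype ι]
    [DecidableEq ι] {f g : ι → κ} (hf : Function.Injective f) (hg : Function.Injective g) :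
    ((Matrix.mvPolynomialX κ κ R).submatrix f g).det ≠ 0 := by
  have h : ((Matrix.mvPolynomialX κ κ R).submatrix f g).det =
      rename (Prod.map f g) (Matrix.mvPolynomialX ι ι R).det := by
    rw [AlgHom.map_det]
    congr 1
    ext i j : 2
    simp [Matrix.mvPolynomialX]
  rw [h, Ne, map_eq_zero_iff _ (rename_injective _ (hf.prodMap hg))]
  exact Matrix.det_mvPolynomialX_ne_zero ι R

theorem isHomogeneous_det_submatrix_mvPolynomialX {ι κ : Type*} [Fintype ι] [DecidableEq ι]
    (f g : ι → κ) :
    ((Matrix.mvPolynomialX κ κ R).submatrix f g).det.IsHomogeneous (Fintype.card ι) := by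
  rw [det_submatrix_mvPolynomialX]
  refine IsHomogeneous.sum _ _ _ fun τ _ => isHomogeneous_monomial _ ?_
  simp [permExponent, map_sum]

theorem adjugate_mvPolynomialX_eq {n : ℕ} (a b : Fin (n + 1)) :
    (Matrix.mvPolynomialX (Fin (n + 1)) (Fin (n + 1)) R).adjugate a b = C ((-1) ^ (b + a : ℕ)) *
      ((Matrix.mvPolynomialX (Fin (n + 1)) (Fin (n + 1)) R).submatrix b.succAbove a.succAbove).det := by
  rw [Matrix.adjugate_fin_succ_eq_det_submatrix]
  simp

theorem isHomogeneous_adjugate_mvPolynomialX {n : ℕ} (a b : Fin n) :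
    ((Matrix.mvPolynomialX (Fin n) (Fin n) R).adjugate a b).IsHomogeneous (n - 1) := by
  cases n with
  | zero => exact a.elim0
  | succ n =>
    rw [adjugate_mvPolynomialX_eq]
    simpa using (isHomogeneous_det_submatrix_mvPolynomialX (R := R) b.succAbove
      a.succAbove).C_mul ((-1) ^ (b + a : ℕ))

theorem adjugate_mvPolynomialX_ne_zero [IsDomain R] {n : ℕ} (a b : Fin n) :
    (Matrix.mvPolynomialX (Fin n) (Fin n) R).adjugate a b ≠ 0 := by
  cases n with
  | zero => exact a.elim0
  | succ n =>
    rw [adjugate_mvPolynomialX_eq]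
    exact mul_ne_zero (by simp) (det_submatrix_mvPolynomialX_ne_zero
      Fin.succAbove_right_injective Fin.succAbove_right_injective)

theorem hasRegularMinors_mvPolynomialX [IsDomain R] (n : ℕ) :
    HasRegularMinors (Matrix.mvPolynomialX (Fin n) (Fin n) R) where
  det_head_ne_zero h := by
    have hinj : Function.Injective (headIndex h) := fun s t hst => by
      simpa [headIndex, Fin.ext_iff] using hst
    exact det_submatrix_mvPolynomialX_ne_zero hinj hinj
  isRegularPair f g hf hg := isRegularPair_minors f g hf hg

theorem totalDegree_aeval_le_of_isHomogeneous {σ τ S : Type*} [CommRing S] [Algebra R S]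
    {p : MvPolynomial σ R} {e : ℕ} (hp : p.IsHomogeneous e) {f : σ → MvPolynomial τ S} {d : ℕ}
    (hf : ∀ v, (f v).totalDegree ≤ d) : (aeval (R := R) f p).totalDegree ≤ e * d := by
  refine le_trans ?_ (Nat.mul_le_mul_right d hp.totalDegree_le)
  rw [aeval_def, eval₂_eq]
  refine totalDegree_finsetSum_le fun c hc => ?_
  refine (totalDegree_mul _ _).trans ?_
  rw [MvPolynomial.algebraMap_apply, totalDegree_C, zero_add]
  refine (totalDegree_finsetProd _ _).trans ?_
  refine le_trans ?_ (Nat.mul_le_mul_right d (le_totalDegree hc))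
  rw [Finsupp.sum, Finset.sum_mul]
  exact Finset.sum_le_sum fun v _ =>
    (totalDegree_pow _ _).trans (Nat.mul_le_mul_left _ (hf v))

theorem leadingMinor_map {S T : Type*} [CommRing S] [CommRing T] (φ : S →+* T) {n : ℕ}
    (A : Matrix (Fin n) (Fin n) S) (K : ℕ) : leadingMinor (A.map φ) K = φ (leadingMinor A K) := by
  rw [leadingMinor, leadingMinor, φ.map_det]
  rfl

theorem totalDegree_genericPolynomialMatrix_le (n r d : ℕ) (s t : Fin n) :
    (genericPolynomialMatrix R n r d s t).totalDegree ≤ d := by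
  rw [genericPolynomialMatrix, Matrix.of_apply]
  refine totalDegree_finsetSum_le fun e he => totalDegree_finsetSum_le fun α hα => ?_
  refine (totalDegree_monomial_le _ _).trans ?_
  rw [Finset.mem_finsuppAntidiag] at hα
  rw [Finsupp.sum_fintype _ _ fun _ => rfl]
  exact hα.1.le.trans (Nat.lt_succ_iff.mp (Finset.mem_range.mp he))

/-- The specialization of the coefficients of the general polynomials of degree `d` that leaves
only the `d`-th powers of the `v`-th variable. -/
noncomputable def purePowerSpecialization (R : Type*) [CommRing R] (n d : ℕ) {r : ℕ} (v : Fin r) :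
    MvPolynomial (Fin n × Fin n × (Fin r →₀ ℕ)) R →ₐ[R] MvPolynomial (Fin n × Fin n) R :=
  aeval fun u => if u.2.2 = Finsupp.single v d then X (u.1, u.2.1) else 0

theorem map_genericPolynomialMatrix (n d : ℕ) {r : ℕ} (v : Fin r) (s t : Fin n) :
    map (purePowerSpecialization R n d v).toRingHom (genericPolynomialMatrix R n r d s t) =
      monomial (Finsupp.single v d) (X (s, t)) := by
  rw [genericPolynomialMatrix, Matrix.of_apply, map_sum, Finset.sum_eq_single d]
  · rw [map_sum, Finset.sum_eq_single (Finsupp.single v d)]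
    · simp [purePowerSpecialization, map_monomial]
    · intro α _ hα
      simp [purePowerSpecialization, map_monomial, hα]
    · intro h
      refine absurd ?_ h
      rw [Finset.mem_finsuppAntidiag]
      exact ⟨by simp, Finset.subset_univ _⟩
  · intro e _ he
    rw [map_sum]
    refine Finset.sum_eq_zero fun α hα => ?_
    have : α ≠ Finsupp.single v d := by
      rintro rfl
      rw [Finset.mem_finsuppAntidiag] at hα
      exact he (by simpa using hα.1.symm)
    simp [purePowerSpecialization, map_monomial, this]
  · simp

/-- Each term of `p` has exactly `e` factors, so all terms contribute the same `e • μ` and cannot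
cancel one another. -/
theorem aeval_monomial_of_isHomogeneous {σ τ : Type*} {p : MvPolynomial σ R} {e : ℕ}
    (hp : p.IsHomogeneous e) (μ : τ →₀ ℕ) :
    aeval (R := R) (fun v => monomial μ (X v : MvPolynomial σ R)) p = monomial (e • μ) p := by
  rw [aeval_def, eval₂_eq]
  conv_rhs => rw [p.as_sum, map_sum]
  refine Finset.sum_congr rfl fun c hc => ?_
  have hdeg : ∑ i ∈ c.support, c i = e := by
    have := hp (mem_support_iff.mp hc)
    simpa [Finsupp.weight_apply, Finsupp.sum] using this
  simp only [monomial_pow]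
  rw [← monomial_sum_prod, ← Finset.sum_smul, hdeg, monomial_eq (s := c),
    MvPolynomial.algebraMap_apply, C_mul_monomial]
  rfl

/-- For the lower bound, specialize every entry to `X (s, t)` times the `d`-th power of one
variable: the result is `p` times the `e * d`-th power of that variable. Specializing coefficients
can only shrink the support, so it does not raise the degree. -/
theorem totalDegree_aeval_genericPolynomialMatrix {n e : ℕ} {p : MvPolynomial (Fin n × Fin n) R}
    (hp : p.IsHomogeneous e) (hp0 : p ≠ 0) {r : ℕ} (hr : 0 < r) (d : ℕ) :
    (aeval (R := R) (fun st => genericPolynomialMatrix R n r d st.1 st.2) p).totalDegree =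
      e * d := by
  apply le_antisymm
  · exact totalDegree_aeval_le_of_isHomogeneous hp fun st =>
      totalDegree_genericPolynomialMatrix_le n r d st.1 st.2
  · have h : map (purePowerSpecialization R n d ⟨0, hr⟩).toRingHom
        (aeval (R := R) (fun st => genericPolynomialMatrix R n r d st.1 st.2) p) =
        monomial (e • Finsupp.single ⟨0, hr⟩ d) p := by
      rw [← aeval_monomial_of_isHomogeneous hp, map_aeval, aeval_def, coe_eval₂Hom]
      congr 1
      · ext1 x
        rw [RingHom.comp_apply, MvPolynomial.algebraMap_apply, map_C]
        exact congrArg C (AlgHom.commutes _ x)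
      · ext1 st
        exact map_genericPolynomialMatrix n d _ st.1 st.2
    have h2 := Finset.sup_mono (f := fun α : Fin r →₀ ℕ => α.sum fun _ c => c) (support_map_subset
      (purePowerSpecialization R n d ⟨0, hr⟩).toRingHom
      (aeval (R := R) (fun st => genericPolynomialMatrix R n r d st.1 st.2) p))
    change totalDegree _ ≤ totalDegree _ at h2
    rw [h, totalDegree_monomial _ hp0, Finsupp.smul_single, Finsupp.sum_single_index rfl] at h2
    exact h2

end Generic

/-! ### The main theorem -/

theorem mainTheorem3 {R : Type*} [CommRing R] [IsDomain R] (m i : ℕ) (hi : i + 3 ≤ m) :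
    (∃ D : Matrix (Fin (2 ^ (m - (i + 1)))) (Fin (2 ^ (m - (i + 1))))
        (MvPolynomial (Fin (2 ^ m) × Fin (2 ^ m)) R),
      IsReducedDelta i (Matrix.mvPolynomialX (Fin (2 ^ m)) (Fin (2 ^ m)) R) D) ∧
    ∀ D : Matrix (Fin (2 ^ (m - (i + 1)))) (Fin (2 ^ (m - (i + 1))))
        (MvPolynomial (Fin (2 ^ m) × Fin (2 ^ m)) R),
      IsReducedDelta i (Matrix.mvPolynomialX (Fin (2 ^ m)) (Fin (2 ^ m)) R) D →
      IsContent
        (leadingMinor (Matrix.mvPolynomialX (Fin (2 ^ m)) (Fin (2 ^ m)) R)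
          ((2 ^ (i + 1) - 1) * 2 ^ m / 2 ^ (i + 1)) ^ (2 ^ m / 2 ^ (i + 1) - 2))
        D.adjugate ∧
      ∃ Q : Matrix (Fin (2 ^ (m - (i + 1)))) (Fin (2 ^ (m - (i + 1))))
          (MvPolynomial (Fin (2 ^ m) × Fin (2 ^ m)) R),
        D.adjugate =
          (leadingMinor (Matrix.mvPolynomialX (Fin (2 ^ m)) (Fin (2 ^ m)) R)
            ((2 ^ (i + 1) - 1) * 2 ^ m / 2 ^ (i + 1)) ^ (2 ^ m / 2 ^ (i + 1) - 2)) • Q ∧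
        (∀ a b, (Q a b).totalDegree = 2 ^ m - 1) ∧
        (∀ (S : Type*) [CommRing S] [Algebra R S] (r d : ℕ)
          (A : Matrix (Fin (2 ^ m)) (Fin (2 ^ m)) (MvPolynomial (Fin r) S)),
          (∀ s t, (A s t).totalDegree ≤ d) →
          (D.map (MvPolynomial.aeval (R := R) fun st => A st.1 st.2)).adjugate =
            (leadingMinor A ((2 ^ (i + 1) - 1) * 2 ^ m / 2 ^ (i + 1)) ^
              (2 ^ m / 2 ^ (i + 1) - 2)) •
              Q.map (MvPolynomial.aeval (R := R) fun st => A st.1 st.2) ∧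
          ∀ a b, (MvPolynomial.aeval (R := R) (fun st => A st.1 st.2) (Q a b)).totalDegree
            ≤ (2 ^ m - 1) * d) ∧
        (∀ r d : ℕ, 0 < r → ∀ a b,
          (MvPolynomial.aeval (R := R)
            (fun st => genericPolynomialMatrix R (2 ^ m) r d st.1 st.2) (Q a b)).totalDegree
            = (2 ^ m - 1) * d) := by
  classical
  obtain ⟨k, rfl⟩ : ∃ k, m = i + 1 + k := ⟨m - (i + 1), by omega⟩
  have hk : 2 ≤ k := by omega
  have hdiv : 2 ^ (i + 1 + k) / 2 ^ (i + 1) = 2 ^ k := by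
    rw [pow_add 2 (i + 1) k, Nat.mul_div_cancel_left _ (by positivity)]
  have hdiv' : (2 ^ (i + 1) - 1) * 2 ^ (i + 1 + k) / 2 ^ (i + 1) = (2 ^ (i + 1) - 1) * 2 ^ k := by
    rw [pow_add 2 (i + 1) k, mul_left_comm, Nat.mul_div_cancel_left _ (by positivity)]
  have hsplit : (2 ^ (i + 1) - 1) * 2 ^ k + 2 ^ k = 2 ^ (i + 1 + k) := by
    rw [← Nat.succ_mul, Nat.succ_eq_add_one, Nat.sub_add_cancel Nat.one_le_two_pow, ← pow_add]
  rw [hdiv, hdiv']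
  generalize (2 ^ (i + 1) - 1) * 2 ^ k = K at hsplit ⊢
  -- This exponent occurs in the matrix types, so it is made a variable before being identified with
  -- `k`.
  generalize hk' : i + 1 + k - (i + 1) = k'
  obtain rfl : k = k' := by omega
  set A₀ := Matrix.mvPolynomialX (Fin (2 ^ (i + 1 + k))) (Fin (2 ^ (i + 1 + k))) R with hA₀
  have hA := hasRegularMinors_mvPolynomialX (R := R) (2 ^ (i + 1 + k))
  have hN : 2 ≤ 2 ^ k := Nat.one_lt_two_pow (by omega)
  refine ⟨⟨_, isReducedDelta_complement i A₀ hsplit hA (by omega) (by omega)⟩, fun D hD => ?_⟩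
  obtain ⟨K', hsplit', u, hu, rfl⟩ := hD.exists_eq_smul hA (by omega)
  obtain rfl : K = K' := by omega
  -- Units of a polynomial ring over a domain are constants, so the ambiguity in `D` does not affect
  -- homogeneity or degree.
  obtain ⟨c, hc, hcu⟩ := MvPolynomial.isUnit_iff_eq_C_of_isReduced.mp hu
  set Q₀ := A₀.adjugate.submatrix (tailIndex hsplit) (tailIndex hsplit) with hQ₀
  -- The adjugate is homogeneous of degree `N - 1`, with `N = 2 ^ k`, so this is the unit it picks
  -- up.
  obtain ⟨u', hu'⟩ : ∃ u', u' = u ^ (2 ^ k - 1) := ⟨_, rfl⟩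
  have hu'C : u' = MvPolynomial.C (c ^ (2 ^ k - 1)) := by rw [hu', hcu, map_pow]
  have hadj : (u • complement hsplit A₀).adjugate =
      leadingMinor A₀ K ^ (2 ^ k - 2) • u' • Q₀ := by
    have hdet : A₀.det ≠ 0 := Matrix.det_mvPolynomialX_ne_zero _ R
    rw [Matrix.adjugate_smul, adjugate_complement hsplit A₀ hN (hA.det_head_ne_zero _) hdet,
      leadingMinor_eq_det hsplit, Fintype.card_fin, smul_comm, ← hu']
  have hQhom (a b : Fin (2 ^ k)) : ((u' • Q₀) a b).IsHomogeneous
      (2 ^ (i + 1 + k) - 1) := by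
    rw [hu'C]
    exact (isHomogeneous_adjugate_mvPolynomialX _ _).C_mul _
  have hQne (a b : Fin (2 ^ k)) : (u' • Q₀) a b ≠ 0 :=
    mul_ne_zero (hu' ▸ pow_ne_zero _ hu.ne_zero)
      (adjugate_mvPolynomialX_ne_zero _ _)
  refine ⟨?_, u' • Q₀, hadj,
    fun a b => (hQhom a b).totalDegree (hQne a b), ?_,
    fun r d hr a b => totalDegree_aeval_genericPolynomialMatrix (hQhom a b) (hQne a b) hr d⟩
  · obtain ⟨a, b, hab⟩ := hA.adjugate hsplit hN
    rw [hadj, smul_comm]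
    exact (isContent_smul hab _).unit_smul (hu' ▸ hu.pow _)
  · intro S _ _ r d A hAd
    set φ := MvPolynomial.aeval (R := R) fun st : Fin (2 ^ (i + 1 + k)) × Fin (2 ^ (i + 1 + k)) =>
      A st.1 st.2 with hφ
    have hmap : A₀.map φ = A := by
      ext1 s t
      simp [hA₀, hφ, Matrix.mvPolynomialX]
    refine ⟨?_, fun a b => ?_⟩
    · have h1 := φ.toRingHom.map_adjugate (u • complement hsplit A₀)
      have h2 := leadingMinor_map φ.toRingHom A₀ K
      simp only [RingHom.mapMatrix_apply, AlgHom.toRingHom_eq_coe, RingHom.coe_coe] at h1 h2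
      rw [hmap] at h2
      rw [← h1, hadj, h2]
      ext1 a b
      simp only [Matrix.map_apply, Matrix.smul_apply, smul_eq_mul, map_mul, map_pow]
    · rw [hφ]
      exact totalDegree_aeval_le_of_isHomogeneous (hQhom a b) fun st => hAd st.1 st.2
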